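/- All rings are commutative with unit. Let $\mathbf A$ be a $k\times l$ matrix with entries in a ring $R$ and with columns $\mathbf c_1,\dots,\mathbf c_l\in R^k$. We use the following notions. (i) $\mathbf A$ is partition regular over $R$ if for every integer $r\ge 1$ and every colouring $\chi\colon R\to\{1,\dots,r\}$ there is a vector $\mathbf x=(x_1,\dots,x_l)^{\intercal}\in R^l$ with $\mathbf x\neq 0$, $\mathbf A\mathbf x=0$ and $\chi(x_1)=\dots=\chi(x_l)$. (ii) If $R$ is a domain with fraction field $K$, then $\mathbf A$ satisfies the columns condition if there exist an integer $m\ge 0$ and a partition $\{1,\dots,l\}=I_0\cup I_1\cup\dots\cup I_m$ into nonempty parts such that $\sum_{i\in I_0}\mathbf c_i=0$ and, for every $t\in\{1,\dots,m\}$, the vector $\sum_{i\in I_t}\mathbf c_i$ lies in the $K$-vector space generated by the columns $\mathbf c_j$ with $j\in I_0\cup\dots\cup I_{t-1}$. (iii) $\mathbf A$ satisfies the generalised columns condition if there exist an integer $m\ge 0$, a partition $\{1,\dots,l\}=I_0\cup I_1\cup\dots\cup I_m$ into nonempty parts, and elements $d_0,d_1,\dots,d_m\in R\setminus\{0\}$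 such that: $d_0\sum_{i\in I_0}\mathbf c_i=0$; for every $t\in\{1,\dots,m\}$ the vector $d_t\sum_{i\in I_t}\mathbf c_i$ lies in the $R$-module generated by the columns $\mathbf c_j$ with $j\in I_0\cup\dots\cup I_{t-1}$; and, if $m>0$, for every $s\ge 0$ the ideal $d_0(d_1\cdots d_m)^sR$ is infinite. **Proposition.** Let $I$ be any set, $n$ a positive integer, and $R=\prod_{i\in I}\mathbb Z/n\mathbb Z$. Let $\mathbf A$ be a $k\times l$ matrix with entries in $R$, and write $\mathbf A=\prod_{i\in I}\mathbf A_i$, where $\mathbf A_i$ is the $k\times l$ matrix with entries in $\mathbb Z/n\mathbb Z$ formed by the $i$-th coordinates of the entries of $\mathbf A$. The following conditions are equivalent: 1. The matrix $\mathbf A$ is partition regular over $R$. 2. There is a prime $p$ dividing $n$ such that either for some $i\in I$ the matrix $\mathbf A_i \bmod p$ (over $\mathbb Z/p\mathbb Z$) satisfies the generalised columns condition, or for infinitely many $i\in I$ the matrix $\mathbf A_i\bmod p$ satisfies the columns condition. -/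

import Mathlib

/-- `A` is partition regular over the `R`-module `M` for `r` colours: every colouring of `M` with
`r` colours admits a nontrivial monochromatic solution of `A m = 0`. -/
def PartitionRegularFor {k l : ℕ} {R : Type*} [CommRing R] (A : Matrix (Fin k) (Fin l) R)
    (M : Type*) [AddCommGroup M] [Module R M] (r : ℕ) : Prop :=
  ∀ χ : M → Fin r, ∃ m : Fin l → M,
    (∀ i : Fin k, ∑ j : Fin l, A i j • m j = 0) ∧ (∀ i j : Fin l, χ (m i) = χ (m j)) ∧ m ≠ 0

/-- `A` is partition regular over the `R`-module `M`, i.e. for any finite number of colours. -/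
def PartitionRegular {k l : ℕ} {R : Type*} [CommRing R] (A : Matrix (Fin k) (Fin l) R)
    (M : Type*) [AddCommGroup M] [Module R M] : Prop :=
  ∀ r : ℕ, 1 ≤ r → PartitionRegularFor A M r

/-- The columns condition over a domain `R` with fraction field `FractionRing R`.
A partition `I_0 ∪ ⋯ ∪ I_m` of the set of columns (into nonempty parts) is encoded by the
surjective map `P` sending a column to the index of its part, so that `I_t = {j | P j = t}`. -/
def ColumnsCondition {k l : ℕ} {R : Type*} [CommRing R] [IsDomain R]
    (A : Matrix (Fin k) (Fin l) R) : Prop :=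
  ∃ (m : ℕ) (P : Fin l → Fin (m + 1)), Function.Surjective P ∧
    (∑ j with P j = 0, A.col j = 0) ∧
    ∀ t : Fin (m + 1), t ≠ 0 →
      ∑ j with P j = t, (A.map (algebraMap R (FractionRing R))).col j ∈
        Submodule.span (FractionRing R)
          ((A.map (algebraMap R (FractionRing R))).col '' {j | P j < t})

/-- The generalised columns condition over a commutative ring `R`; partitions are encoded
by surjective maps as in `ColumnsCondition`. -/
def GeneralisedColumnsCondition {k l : ℕ} {R : Type*} [CommRing R]
    (A : Matrix (Fin k) (Fin l) R) : Prop :=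
  ∃ (m : ℕ) (P : Fin l → Fin (m + 1)) (d : Fin (m + 1) → R), Function.Surjective P ∧
    (∀ t, d t ≠ 0) ∧
    (d 0 • ∑ j with P j = 0, A.col j = 0) ∧
    (∀ t : Fin (m + 1), t ≠ 0 →
      d t • ∑ j with P j = t, A.col j ∈ Submodule.span R (A.col '' {j | P j < t})) ∧
    (0 < m → ∀ n : ℕ,
      (Ideal.span {d 0 * (∏ t : Fin m, d t.succ) ^ n} : Set R).Infinite)

/-! The `p`-torsion of `ZMod n` is a copy of `ZMod p` on which `ZMod n` acts through reduction mod
`p`, so everything reduces to linear algebra over `ZMod p`. Sufficiency: if the columns sum to zero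
mod `p` at one `i`, a constant vector supported at `i` solves the system. If the columns condition
holds at infinitely many `i`, infinitely many share one reduction `C`; solutions for `C` in `(ZMod
p)^d` come from Hales-Jewett (`ColumnsCondition.exists_mono_solution`). Necessity: well-order `I`
and colour by leading coefficients along each set of coordinates with equal `A_i`, and by the values
where that set is finite. A monochromatic solution, multiplied into the `p`-torsion, yields one of
the two conditions (`columnsCondition_of_leading`). -/

/-! ### Ramsey theory over finite fields -/

/-- Over a finite field, every finite colouring of a space of large dimension admits vectors
`u 0, …, u (M - 1)` such that the colour of a combination whose first nonzero coefficient is `1`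
depends only on the position of this coefficient; moreover such combinations are nonzero. -/
theorem exists_rows_mono (F : Type*) [Field F] [Finite F] (κ : Type*) [Finite κ] (M : ℕ) :
    ∃ d : ℕ, ∀ χ : (Fin d → F) → κ, ∃ (u : Fin M → Fin d → F) (c : Fin M → κ),
      ∀ (t : Fin M) (a : Fin M → F), a t = 1 → (∀ s < t, a s = 0) →
        ∑ s, a s • u s ≠ 0 ∧ χ (∑ s, a s • u s) = c t := by
  induction M with
  | zero => exact ⟨0, fun χ => ⟨fun _ => 0, Fin.elim0, fun t => t.elim0⟩⟩
  | succ M ih =>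
    obtain ⟨d, hd⟩ := ih
    obtain ⟨D, hD⟩ :=
      Combinatorics.Subspace.exists_mono_in_high_dimension_fin F κ (Fin d)
    refine ⟨D + 1, fun χ => ?_⟩
    -- Hales-Jewett on the affine hyperplane of first coordinate `1`. The direction space of `S`,
    -- parametrised by `Φ`, has first coordinate `0` and carries the induction.
    obtain ⟨S, c₀, hc₀⟩ := hD fun x => χ (Fin.cons 1 x)
    let Φ : (Fin d → F) →ₗ[F] (Fin (D + 1) → F) :=
      { toFun := fun x => Fin.cons 0 fun i => (S.idxFun i).elim (fun _ => 0) x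
        map_add' := by
          intro x y
          ext i
          refine Fin.cases (by simp) (fun i => ?_) i
          cases h : S.idxFun i <;> simp [h]
        map_smul' := by
          intro r x
          ext i
          refine Fin.cases (by simp) (fun i => ?_) i
          cases h : S.idxFun i <;> simp [h] }
    have hΦ0 : ∀ x, Φ x = 0 → x = 0 := by
      intro x hx
      ext e
      obtain ⟨i, hi⟩ := S.proper e
      simpa [Φ, hi] using congrFun hx i.succ
    have hΦS : ∀ x, (Fin.cons 1 (S 0) : Fin (D + 1) → F) + Φ x = Fin.cons 1 (S x) := by
      intro x
      ext i
      refine Fin.cases (by simp [Φ]) (fun i => ?_) i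
      cases h : S.idxFun i <;> simp [Φ, h, Combinatorics.Subspace.coe_apply]
    obtain ⟨u, c, huc⟩ := hd fun x => χ (Φ x)
    refine ⟨Fin.cons (Fin.cons 1 (S 0)) fun s => Φ (u s), Fin.cons c₀ c, fun t a => ?_⟩
    have hsum : ∑ s, a s • (Fin.cons (Fin.cons 1 (S 0)) (fun s => Φ (u s)) :
        Fin (M + 1) → Fin (D + 1) → F) s =
        a 0 • (Fin.cons 1 (S 0) : Fin (D + 1) → F) + Φ (∑ s : Fin M, a s.succ • u s) := by
      rw [Fin.sum_univ_succ]
      simp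
    rw [hsum]
    refine Fin.cases (fun h1 _ => ?_) (fun t h1 h0 => ?_) t
    · rw [h1, one_smul, hΦS]
      exact ⟨fun h => one_ne_zero (congrFun h 0 : (1 : F) = 0), by simpa using hc₀ _⟩
    · rw [h0 0 (Fin.succ_pos t), zero_smul, zero_add]
      have := huc t (fun s => a s.succ) h1 fun s hs => h0 _ (Fin.succ_lt_succ_iff.2 hs)
      exact ⟨fun h => this.1 (hΦ0 _ h), by simpa using this.2⟩

/-- Over a finite field, every finite colouring of a space of large dimension admits vectors
`u 0, …, u (M - 1)` such that all combinations whose first nonzero coefficient is `1` are nonzero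
and have the same colour. -/
theorem exists_mono_normalized_combinations (F : Type*) [Field F] [Finite F] (κ : Type*) [Finite κ]
    (M : ℕ) :
    ∃ d : ℕ, ∀ χ : (Fin d → F) → κ, ∃ (u : Fin M → Fin d → F) (c : κ),
      ∀ (t : Fin M) (a : Fin M → F), a t = 1 → (∀ s < t, a s = 0) →
        ∑ s, a s • u s ≠ 0 ∧ χ (∑ s, a s • u s) = c := by
  classical
  have := Fintype.ofFinite κ
  obtain ⟨d, hd⟩ := exists_rows_mono F κ (Fintype.card κ * M + 1)
  refine ⟨d, fun χ => ?_⟩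
  obtain ⟨u, c, huc⟩ := hd χ
  -- Pigeonhole on positions; the order embedding `e` and extension by zero keep leading
  -- coefficients leading.
  obtain ⟨y, hy⟩ := Fintype.exists_lt_card_fiber_of_mul_lt_card c (n := M) (by simp)
  let e := Finset.orderEmbOfCardLe _ hy.le
  have he : ∀ s, c (e s) = y := fun s => by
    simpa using Finset.orderEmbOfCardLe_mem _ hy.le s
  refine ⟨fun s => u (e s), y, fun t a h1 h0 => ?_⟩
  have hval : ∀ s, Function.extend e a 0 (e s) = a s := e.injective.extend_apply a 0
  have key := huc (e t) (Function.extend e a 0) (by rw [hval, h1]) (by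
    intro s hs
    by_cases h : ∃ s', e s' = s
    · obtain ⟨s', rfl⟩ := h
      rw [hval, h0 _ (e.lt_iff_lt.1 hs)]
    · rw [Function.extend_apply' _ _ _ h, Pi.zero_apply])
  have hsum : ∑ s, Function.extend e a 0 s • u s = ∑ s, a s • u (e s) := by
    simp_rw [← hval]
    refine (Fintype.sum_of_injective e e.injective _ _ ?_ fun _ => rfl).symm
    intro s hs
    rw [Function.extend_apply' _ _ _ (by simpa using hs), Pi.zero_apply, zero_smul]
  rwa [hsum, he] at key

/-! ### From the columns condition to monochromatic solutions -/

/-- Membership in the span of a subfamily of a finite family. -/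
theorem mem_span_image_iff_exists_coeff {ι R M : Type*} [Fintype ι] [Ring R] [AddCommGroup M]
    [Module R M] (v : ι → M) (s : Set ι) (x : M) :
    x ∈ Submodule.span R (v '' s) ↔ ∃ c : ι → R, (∀ j, j ∉ s → c j = 0) ∧ ∑ j, c j • v j = x := by
  classical
  rw [Finsupp.mem_span_image_iff_linearCombination]
  constructor
  · rintro ⟨c, hc, rfl⟩
    refine ⟨c, fun j hj => ?_, ?_⟩
    · by_contra h
      exact hj (hc (Finsupp.mem_support_iff.2 h))
    · rw [Finsupp.linearCombination_apply, Finsupp.sum_fintype _ _ (by simp)]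
  · rintro ⟨c, hc, rfl⟩
    refine ⟨Finsupp.equivFunOnFinite.symm c, fun j hj => ?_, ?_⟩
    · by_contra h
      simp [hc j h] at hj
    · rw [Finsupp.linearCombination_apply, Finsupp.sum_fintype _ _ (by simp)]
      simp

/-- The columns condition over a field, with the coefficients made explicit. -/
theorem ColumnsCondition.exists_coeff {F : Type*} [Field F] {k l : ℕ}
    {C : Matrix (Fin k) (Fin l) F} (hC : ColumnsCondition C) :
    ∃ (m : ℕ) (P : Fin l → Fin (m + 1)) (b : Fin (m + 1) → Fin l → F), Function.Surjective P ∧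
      (∀ t j, P j = t → b t j = 1) ∧ (∀ t j, t < P j → b t j = 0) ∧
      ∀ t i, ∑ j, b t j * C i j = 0 := by
  classical
  obtain ⟨m, P, hP, h0, ht⟩ := hC
  have hbij : Function.Bijective (algebraMap F (FractionRing F)) :=
    Field.localization_map_bijective (M := nonZeroDivisors F) (by simp)
  refine ⟨m, P, ?_⟩
  suffices h : ∀ t, ∃ b : Fin l → F, (∀ j, P j = t → b j = 1) ∧ (∀ j, t < P j → b j = 0) ∧
      ∀ i, ∑ j, b j * C i j = 0 by
    choose b hb1 hb0 hb using h
    exact ⟨b, hP, hb1, hb0, hb⟩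
  intro t
  by_cases htz : t = 0
  · subst htz
    refine ⟨fun j => if P j = 0 then 1 else 0, by simp +contextual,
      fun j hj => if_neg hj.ne', fun i => ?_⟩
    simpa [Finset.sum_filter, ite_mul, Finset.sum_apply] using congrFun h0 i
  · have h := ht t htz
    rw [mem_span_image_iff_exists_coeff] at h
    obtain ⟨c, hc0, hc⟩ := h
    choose g hg using hbij.2
    refine ⟨fun j => if P j = t then 1 else - g (c j),
      by simp +contextual, fun j hj => ?_, fun i => ?_⟩
    · apply hbij.1
      simp [hj.ne', hg, hc0 j hj.not_gt]
    apply hbij.1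
    have hci := congrFun hc i
    simp only [Finset.sum_apply, Pi.smul_apply, smul_eq_mul, Matrix.col_apply,
      Matrix.map_apply, Finset.sum_filter] at hci
    rw [map_sum, map_zero, ← sub_eq_zero.2 hci.symm, ← Finset.sum_sub_distrib]
    refine Finset.sum_congr rfl fun j _ => ?_
    by_cases h1 : P j = t
    · simp [h1, hc0 j h1.not_lt]
    · simp [h1, hg]

/-- A matrix over a finite field with the columns condition has monochromatic nontrivial solutions
in every finite colouring of a space of large dimension. -/
theorem ColumnsCondition.exists_mono_solution {F : Type*} [Field F] [Finite F] {k l : ℕ}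
    {C : Matrix (Fin k) (Fin l) F} (hC : ColumnsCondition C) (κ : Type*) [Finite κ] :
    ∃ d : ℕ, ∀ χ : (Fin d → F) → κ, ∃ x : Fin l → Fin d → F,
      (∀ i, ∑ j, C i j • x j = 0) ∧ (∀ j j', χ (x j) = χ (x j')) ∧ x ≠ 0 := by
  obtain ⟨m, P, b, hP, hb1, hb0, hb⟩ := hC.exists_coeff
  obtain ⟨d, hd⟩ := exists_mono_normalized_combinations F κ (m + 1)
  refine ⟨d, fun χ => ?_⟩
  obtain ⟨u, c, huc⟩ := hd χ
  -- Column `j` of `b` has leading coefficient `1` at `P j`; the rows of `b` are killed by `C`.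
  have key := fun j => huc (P j) (fun t => b t j) (hb1 _ _ rfl) fun s hs => hb0 _ _ hs
  refine ⟨fun j => ∑ t, b t j • u t, fun i => ?_, fun j j' => (key j).2.trans (key j').2.symm,
    fun h => ?_⟩
  · simp_rw [Finset.smul_sum, smul_smul]
    rw [Finset.sum_comm]
    refine Finset.sum_eq_zero fun t _ => ?_
    rw [← Finset.sum_smul]
    simp_rw [mul_comm (C i _)]
    rw [hb, zero_smul]
  · obtain ⟨j, -⟩ := hP 0
    exact (key j).1 (congrFun h j)

theorem PartitionRegular.exists_mono {k l : ℕ} {R M : Type*} [CommRing R] [AddCommGroup M]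
    [Module R M] {A : Matrix (Fin k) (Fin l) R} (hA : PartitionRegular A M) {κ : Type*} [Finite κ]
    [Nonempty κ] (χ : M → κ) :
    ∃ x : Fin l → M, (∀ i, ∑ j, A i j • x j = 0) ∧ (∀ j j', χ (x j) = χ (x j')) ∧ x ≠ 0 := by
  have := Fintype.ofFinite κ
  let e := Fintype.equivFin κ
  obtain ⟨x, h1, h2, h3⟩ := hA _ Fintype.card_pos fun y => e (χ y)
  exact ⟨x, h1, fun j j' => e.injective (h2 j j'), h3⟩

/-! ### Torsion, and necessity of the conditions -/

/-- The `p`-torsion of `ZMod n` is a copy of `ZMod p`, compatibly with multiplication. -/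
theorem ZMod.exists_torsion_embedding {n p : ℕ} (hn : 0 < n) (hpn : p ∣ n) :
    ∃ ψ : ZMod p →+ ZMod n, Function.Injective ψ ∧
      (∀ c z, ψ (ZMod.castHom hpn (ZMod p) c * z) = c * ψ z) ∧
      ∀ y : ZMod n, (p : ZMod n) * y = 0 → ∃ z, ψ z = y := by
  obtain ⟨q, rfl⟩ := hpn
  have hq : (q : ℤ) ≠ 0 := by
    rintro h
    simp_all
  have hp : (p : ℤ) ≠ 0 := by
    rintro h
    simp_all
  -- Multiplication by `q = n / p`.
  let ψ : ZMod p →+ ZMod (p * q) := ZMod.lift p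
    ⟨zmultiplesHom _ (q : ZMod (p * q)), by
      rw [zmultiplesHom_apply, natCast_zsmul, nsmul_eq_mul, ← Nat.cast_mul, ZMod.natCast_self]⟩
  have hψ : ∀ a : ℤ, ψ a = ((a * q : ℤ) : ZMod (p * q)) := fun a => by
    simp [ψ]
  refine ⟨ψ, ?_, ?_, ?_⟩
  · rw [injective_iff_map_eq_zero]
    intro z hz
    obtain ⟨a, rfl⟩ := ZMod.intCast_surjective z
    rw [hψ, ZMod.intCast_zmod_eq_zero_iff_dvd] at hz
    rw [ZMod.intCast_zmod_eq_zero_iff_dvd]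
    push_cast at hz
    exact Int.dvd_of_mul_dvd_mul_right hq hz
  · intro c z
    obtain ⟨a, rfl⟩ := ZMod.intCast_surjective z
    obtain ⟨b, rfl⟩ := ZMod.intCast_surjective c
    rw [map_intCast, ← Int.cast_mul, hψ, hψ]
    push_cast
    ring
  · intro y hy
    obtain ⟨a, rfl⟩ := ZMod.intCast_surjective y
    have h : (((p : ℤ) * a : ℤ) : ZMod (p * q)) = 0 := by exact_mod_cast hy
    rw [ZMod.intCast_zmod_eq_zero_iff_dvd] at h
    push_cast at h
    obtain ⟨b, rfl⟩ := Int.dvd_of_mul_dvd_mul_left hp h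
    exact ⟨b, by rw [hψ, mul_comm b]⟩

/-- Solutions with a common leading coefficient force the columns condition. -/
theorem columnsCondition_of_leading {F J : Type*} [Field F] [LinearOrder J] {k l : ℕ} (hl : 0 < l)
    {C : Matrix (Fin k) (Fin l) F} (z : Fin l → J → F) (pos : Fin l → J) {v : F} (hv : v ≠ 0)
    (hz : ∀ i e, ∑ j, C i j * z j e = 0) (hpos : ∀ j, z j (pos j) = v)
    (h0 : ∀ j, ∀ e < pos j, z j e = 0) : ColumnsCondition C := by
  classical
  have : Nonempty (Fin l) := ⟨⟨0, hl⟩⟩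
  obtain ⟨m, hm⟩ : ∃ m, (Finset.univ.image pos).card = m + 1 :=
    Nat.exists_eq_succ_of_ne_zero (Finset.card_pos.2 (Finset.univ_nonempty.image _)).ne'
  let e := (Finset.univ.image pos).orderEmbOfFin hm
  have hrange : Set.range e = Finset.univ.image pos := Finset.range_orderEmbOfFin _ hm
  have hP : ∀ j, ∃ t, e t = pos j := fun j => by
    have : pos j ∈ Set.range e := by simp [hrange]
    exact this
  choose P hP using hP
  -- Read the system at coordinate `e t` and divide by `v`: columns of later parts contribute `0`,
  -- those of part `t` contribute with coefficient `1`.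
  have hsum : ∀ t i, ∑ j, (if P j = t then C i j else 0) =
      ∑ j, (if P j < t then - (z j (e t) / v) else 0) * C i j := by
    intro t i
    have h : ∑ j, C i j * z j (e t) / v = 0 := by rw [← Finset.sum_div, hz, zero_div]
    rw [← sub_eq_zero, ← Finset.sum_sub_distrib]
    refine Eq.trans ?_ h
    refine Finset.sum_congr rfl fun j _ => ?_
    rcases lt_trichotomy (P j) t with hjt | hjt | hjt
    · simp only [hjt.ne, hjt, if_true, if_false]
      ring
    · subst hjt
      simp [hP, hpos, hv]
    · rw [h0 j (e t) (by rw [← hP]; exact e.lt_iff_lt.2 hjt)]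
      simp [hjt.ne', hjt.not_gt]
  refine ⟨m, P, fun t => ?_, ?_, fun t _ => ?_⟩
  · have : e t ∈ Set.range e := ⟨t, rfl⟩
    rw [hrange] at this
    obtain ⟨j, hj⟩ : ∃ j, pos j = e t := by simpa using this
    exact ⟨j, e.injective (by rw [hP, hj])⟩
  · ext i
    simpa [Finset.sum_apply, Finset.sum_filter] using hsum 0 i
  · rw [mem_span_image_iff_exists_coeff]
    refine ⟨fun j => algebraMap _ _ (if P j < t then - (z j (e t) / v) else 0), ?_, ?_⟩
    · intro j hj
      have hj' : ¬ P j < t := hj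
      simp [hj']
    · ext i
      have := congrArg (algebraMap F (FractionRing F)) (hsum t i)
      simp only [map_sum, map_mul] at this
      simp only [Finset.sum_apply, Pi.smul_apply, smul_eq_mul, Matrix.col_apply,
        Matrix.map_apply, Finset.sum_filter]
      rw [← this]
      refine Finset.sum_congr rfl fun j _ => ?_
      split_ifs <;> simp

/-- Over a finite field, the generalised columns condition says that the columns sum to zero. -/
theorem generalisedColumnsCondition_iff {F : Type*} [Field F] [Finite F] {k l : ℕ}
    {C : Matrix (Fin k) (Fin l) F} :
    GeneralisedColumnsCondition C ↔ 0 < l ∧ ∀ i, ∑ j, C i j = 0 := by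
  constructor
  · rintro ⟨m, P, d, hP, hd, h0, -, hinf⟩
    -- No ideal of a finite ring is infinite.
    obtain rfl : m = 0 := by
      by_contra h
      exact hinf (Nat.pos_of_ne_zero h) 0 (Set.toFinite _)
    refine ⟨Fin.pos (hP 0).choose, fun i => ?_⟩
    have h := congrFun ((smul_eq_zero.1 h0).resolve_left (hd 0)) i
    simpa [Finset.sum_apply, Subsingleton.elim _ (0 : Fin 1)] using h
  · rintro ⟨hl, h⟩
    refine ⟨0, fun _ => 0, fun _ => 1, fun t => ⟨⟨0, hl⟩, by omega⟩, by simp, ?_,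
      fun t ht => (ht (by omega)).elim, by simp⟩
    ext i
    simpa [Finset.sum_apply] using h i

/-- A function choosing the leading coefficient of the restriction of `y` to `T`. -/
theorem exists_leadingCoeff (I B : Type*) [LinearOrder I] [WellFoundedLT I] [Zero B] :
    ∃ lead : Set I → (I → B) → B, ∀ T y,
      ((∀ i ∈ T, y i = 0) ∧ lead T y = 0) ∨
        ∃ i ∈ T, y i = lead T y ∧ lead T y ≠ 0 ∧ ∀ e ∈ T, e < i → y e = 0 := by
  suffices h : ∀ (T : Set I) (y : I → B), ∃ b : B, ((∀ i ∈ T, y i = 0) ∧ b = 0) ∨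
      ∃ i ∈ T, y i = b ∧ b ≠ 0 ∧ ∀ e ∈ T, e < i → y e = 0 by
    choose lead hlead using h
    exact ⟨lead, hlead⟩
  intro T y
  by_cases h : ∃ i, i ∈ T ∧ y i ≠ 0
  · obtain ⟨i, ⟨hi, hy⟩, hmin⟩ := WellFounded.has_min wellFounded_lt {i | i ∈ T ∧ y i ≠ 0} h
    refine ⟨y i, Or.inr ⟨i, hi, rfl, hy, fun e he hei => ?_⟩⟩
    by_contra hne
    exact hmin e ⟨he, hne⟩ hei
  · push Not at h
    exact ⟨0, Or.inl ⟨h, rfl⟩⟩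

/-- A nonzero element killed by `n` has a nonzero multiple killed by a prime divisor of `n`. -/
theorem exists_nsmul_torsion {G : Type*} [AddGroup G] {n : ℕ} (hn : 0 < n) {x : G} (hx : x ≠ 0)
    (hnx : n • x = 0) : ∃ p d : ℕ, p.Prime ∧ p ∣ n ∧ d • x ≠ 0 ∧ p • d • x = 0 := by
  have hdvd := addOrderOf_dvd_of_nsmul_eq_zero hnx
  have h1 : addOrderOf x ≠ 1 := fun h => hx (AddMonoid.addOrderOf_eq_one_iff.1 h)
  have hpos : 0 < addOrderOf x := Nat.pos_of_dvd_of_pos hdvd hn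
  obtain ⟨p, hp, hpx⟩ := Nat.exists_prime_and_dvd h1
  obtain ⟨d, hd⟩ := hpx
  have hd0 : 0 < d := Nat.pos_of_ne_zero fun h => by rw [h, mul_zero] at hd; omega
  refine ⟨p, d, hp, (Dvd.intro _ hd.symm).trans hdvd, fun h => ?_, ?_⟩
  · have := Nat.le_of_dvd hd0 (addOrderOf_dvd_of_nsmul_eq_zero h)
    rw [hd] at this
    nlinarith [hp.two_le]
  · rw [← mul_nsmul', ← hd, addOrderOf_nsmul_eq_zero]

/-- A finite union of finite fibres. It keeps the number of colours finite when the values at these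
coordinates are recorded. -/
theorem Set.finite_setOf_finite_fiber {α β : Type*} [Finite β] (f : α → β) :
    {a | (f ⁻¹' {f a}).Finite}.Finite := by
  refine (Set.finite_iUnion fun b : {b // (f ⁻¹' {b}).Finite} => b.2).subset fun a ha => ?_
  exact Set.mem_iUnion.2 ⟨⟨f a, ha⟩, rfl⟩

theorem exists_columnsCondition_of_partitionRegular {I : Type*} {n : ℕ} (hn : 0 < n) {k l : ℕ}
    {A : Matrix (Fin k) (Fin l) (I → ZMod n)} (hA : PartitionRegular A (I → ZMod n)) :
    ∃ (p : ℕ) (_ : Fact p.Prime) (hpn : p ∣ n),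
        (∃ i : I, GeneralisedColumnsCondition
          ((A.map (fun a => a i)).map (ZMod.castHom hpn (ZMod p)))) ∨
        {i : I | ColumnsCondition
          ((A.map (fun a => a i)).map (ZMod.castHom hpn (ZMod p)))}.Infinite := by
  have : NeZero n := ⟨hn.ne'⟩
  obtain ⟨_, _⟩ := exists_wellFoundedLT I
  obtain ⟨lead, hlead⟩ := exists_leadingCoeff I (ZMod n)
  let comp : I → Matrix (Fin k) (Fin l) (ZMod n) := fun i => A.map (fun a => a i)
  have hS := Set.finite_setOf_finite_fiber comp
  have := hS.to_subtype
  -- The multiplier bringing `x` into the torsion depends on `x`, so the colour records leading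
  -- coefficients for every multiplier in `ZMod n`.
  obtain ⟨x, hx, hmono, hx0⟩ := hA.exists_mono
    (κ := (ZMod n → Matrix (Fin k) (Fin l) (ZMod n) → ZMod n) ×
      ({i | (comp ⁻¹' {comp i}).Finite} → ZMod n))
    fun y => (fun d C => lead (comp ⁻¹' {C}) (fun i => d * y i), fun i => y i)
  obtain ⟨p, d, hp, hpn, hd, hpd⟩ := exists_nsmul_torsion hn hx0 (by ext; simp)
  have := Fact.mk hp
  refine ⟨p, this, hpn, ?_⟩
  obtain ⟨ψ, hψinj, hψmul, hψsurj⟩ := ZMod.exists_torsion_embedding hn hpn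
  have hz : ∀ j i, ∃ z, ψ z = d * x j i := fun j i => hψsurj _ (by
    simpa using congrFun (congrFun hpd j) i)
  choose z hz using hz
  obtain ⟨j₀, i₀, hji⟩ : ∃ j i, (d : ZMod n) * x j i ≠ 0 := by
    by_contra! h
    exact hd (by ext j i; simpa using h j i)
  have hsol : ∀ a i, ∑ j, ZMod.castHom hpn (ZMod p) (A a j i) * z j i = 0 := by
    intro a i
    apply hψinj
    simp_rw [map_sum, hψmul, hz, mul_left_comm _ (d : ZMod n), ← Finset.mul_sum]
    have := congrFun (hx a) i
    simp only [Finset.sum_apply, smul_eq_mul, Pi.mul_apply, Pi.zero_apply] at this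
    rw [this, mul_zero, map_zero]
  by_cases hfin : (comp ⁻¹' {comp i₀}).Finite
  · left
    refine ⟨i₀, generalisedColumnsCondition_iff.2 ⟨Fin.pos j₀, fun a => ?_⟩⟩
    -- The colour records the value at `i₀`, so the solution is a nonzero constant there and the
    -- columns sum to zero.
    have hconst : ∀ j, z j i₀ = z j₀ i₀ := fun j => hψinj (by
      have : x j i₀ = x j₀ i₀ := congrFun (congrArg Prod.snd (hmono j j₀)) ⟨i₀, hfin⟩
      rw [hz, hz, this])
    have h := hsol a i₀
    simp_rw [hconst, ← Finset.sum_mul] at h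
    refine (mul_eq_zero.1 h).resolve_right fun h0 => hji ?_
    rw [← hz, h0, map_zero]
  · right
    have hlead' : ∀ j, ∃ i : comp ⁻¹' {comp i₀},
        d * x j i = lead (comp ⁻¹' {comp i₀}) (fun i => d * x j₀ i) ∧
        lead (comp ⁻¹' {comp i₀}) (fun i => d * x j₀ i) ≠ 0 ∧
        ∀ e : comp ⁻¹' {comp i₀}, e < i → d * x j e = 0 := by
      intro j
      have h : lead (comp ⁻¹' {comp i₀}) (fun i => d * x j i) =
          lead (comp ⁻¹' {comp i₀}) (fun i => d * x j₀ i) :=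
        congrFun (congrFun (congrArg Prod.fst (hmono j j₀)) d) (comp i₀)
      have hne : lead (comp ⁻¹' {comp i₀}) (fun i => d * x j₀ i) ≠ 0 := by
        rcases hlead (comp ⁻¹' {comp i₀}) (fun i => d * x j₀ i) with h | ⟨_, _, _, h, _⟩
        · exact (hji (h.1 i₀ rfl)).elim
        · exact h
      rcases hlead (comp ⁻¹' {comp i₀}) (fun i => d * x j i) with h' | ⟨i, hi, h1, h2, h3⟩
      · exact (hne (h ▸ h'.2)).elim
      · exact ⟨⟨i, hi⟩, h1.trans h, hne, fun e he => h3 e e.2 he⟩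
    choose pos hpos hne hpos0 using hlead'
    refine Set.Infinite.mono (fun i hi => ?_) hfin
    have hi' : A.map (fun a => a i) = A.map (fun a => a i₀) := hi
    change ColumnsCondition _
    rw [hi']
    refine columnsCondition_of_leading (J := comp ⁻¹' {comp i₀}) (Fin.pos j₀)
      (fun j e => z j e) pos (v := z j₀ (pos j₀)) ?_ ?_ ?_ ?_
    · intro h
      apply hne j₀
      rw [← hpos j₀, ← hz, h, map_zero]
    · intro a e
      have he : ∀ j, A a j e = A a j i₀ := fun j => congrFun (congrFun e.2 a) j
      simpa [he] using hsol a e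
    · intro j
      apply hψinj
      rw [hz, hz, hpos, hpos]
    · intro j e he
      apply hψinj
      rw [hz, hpos0 j e he, map_zero]

/-! ### Sufficiency of the conditions -/

theorem partitionRegular_of_generalisedColumnsCondition {I : Type*} {n p : ℕ} (hn : 0 < n)
    [Fact p.Prime] (hpn : p ∣ n) {k l : ℕ} {A : Matrix (Fin k) (Fin l) (I → ZMod n)} {i : I}
    (hi : GeneralisedColumnsCondition
      ((A.map (fun a => a i)).map (ZMod.castHom hpn (ZMod p)))) :
    PartitionRegular A (I → ZMod n) := by
  classical
  obtain ⟨hl, hsum⟩ := generalisedColumnsCondition_iff.1 hi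
  obtain ⟨ψ, hψinj, hψmul, -⟩ := ZMod.exists_torsion_embedding hn hpn
  intro r _ χ
  refine ⟨fun _ => Pi.single i (ψ 1), fun a => ?_, fun _ _ => rfl, fun h => ?_⟩
  · ext e
    simp only [Finset.sum_apply, smul_eq_mul, Pi.mul_apply, Pi.zero_apply]
    by_cases he : e = i
    · subst he
      simp_rw [Pi.single_eq_same, ← hψmul, mul_one]
      rw [← map_sum]
      exact (congrArg ψ (hsum a)).trans (map_zero ψ)
    · simp [Pi.single_eq_of_ne he]
  · have := congrFun (congrFun h ⟨0, hl⟩) i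
    simp only [Pi.single_eq_same, Pi.zero_apply] at this
    exact one_ne_zero (hψinj (this.trans (map_zero ψ).symm))

theorem partitionRegular_of_infinite_columnsCondition {I : Type*} {n p : ℕ} (hn : 0 < n)
    [Fact p.Prime] (hpn : p ∣ n) {k l : ℕ} {A : Matrix (Fin k) (Fin l) (I → ZMod n)}
    (hA : {i : I | ColumnsCondition
      ((A.map (fun a => a i)).map (ZMod.castHom hpn (ZMod p)))}.Infinite) :
    PartitionRegular A (I → ZMod n) := by
  obtain ⟨ψ, hψinj, hψmul, -⟩ := ZMod.exists_torsion_embedding hn hpn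
  have := hA.to_subtype
  let red : I → Matrix (Fin k) (Fin l) (ZMod p) :=
    fun i => (A.map (fun a => a i)).map (ZMod.castHom hpn (ZMod p))
  obtain ⟨C, hC⟩ := Finite.exists_infinite_fiber fun i : {i : I | ColumnsCondition (red i)} => red i
  intro r _ χ
  obtain ⟨⟨i, hi⟩, hiC⟩ := hC.nonempty
  have hCC : ColumnsCondition C := by
    rw [← show red i = C from hiC]
    exact hi
  obtain ⟨d, hd⟩ := hCC.exists_mono_solution (Fin r)
  let f := Infinite.natEmbedding
    ((fun i : {i : I | ColumnsCondition (red i)} => red i) ⁻¹' {C})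
  let g : Fin d ↪ I := (Fin.valEmbedding.trans f).trans
    ((Function.Embedding.subtype _).trans (Function.Embedding.subtype _))
  have hg : ∀ e, red (g e) = C := fun e => (f e).2
  -- Pull the colouring back to `(ZMod p)^d`, placed on `d` coordinates with reduction `C` and
  -- extended by zero.
  obtain ⟨x, hx, hmono, hx0⟩ := hd fun y => χ (Function.extend g (ψ ∘ y) 0)
  refine ⟨fun j => Function.extend g (ψ ∘ x j) 0, fun a => ?_, hmono, fun h => hx0 ?_⟩
  · ext i
    simp only [Finset.sum_apply, smul_eq_mul, Pi.mul_apply, Pi.zero_apply]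
    by_cases hi : ∃ e, g e = i
    · obtain ⟨e, rfl⟩ := hi
      simp_rw [g.injective.extend_apply, Function.comp_apply, ← hψmul, ← map_sum]
      have h := congrFun (hx a) e
      rw [← hg e] at h
      simp only [Finset.sum_apply, Pi.smul_apply, smul_eq_mul, Pi.zero_apply, red,
        Matrix.map_apply] at h
      rw [h, map_zero]
    · simp [Function.extend_apply' _ _ _ hi]
  · ext j e
    have := congrFun (congrFun h j) (g e)
    simp only [g.injective.extend_apply, Function.comp_apply, Pi.zero_apply] at this
    rw [hψinj (this.trans (map_zero ψ).symm)]
    rfl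

theorem mainTheorem7 {I : Type*} (n : ℕ) (hn : 0 < n) {k l : ℕ}
    (A : Matrix (Fin k) (Fin l) (I → ZMod n)) :
    PartitionRegular A (I → ZMod n) ↔
      ∃ (p : ℕ) (_ : Fact p.Prime) (hpn : p ∣ n),
        (∃ i : I, GeneralisedColumnsCondition
          ((A.map (fun a => a i)).map (ZMod.castHom hpn (ZMod p)))) ∨
        {i : I | ColumnsCondition
          ((A.map (fun a => a i)).map (ZMod.castHom hpn (ZMod p)))}.Infinite := by
  refine ⟨exists_columnsCondition_of_partitionRegular hn, ?_⟩
  rintro ⟨p, _, hpn, ⟨i, hi⟩ | hinf⟩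
  · exact partitionRegular_of_generalisedColumnsCondition hn hpn hi
  · exact partitionRegular_of_infinite_columnsCondition hn hpn hinf
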